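/- **Conventions.** A *tangent structure* on a category $\mathscr C$ is a tuple $\mathbb T=(T,p,0,+,\ell,c)$, where $T:\mathscr C\to\mathscr C$ is a functor and $p:T\Rightarrow \mathrm{id}$, $0:\mathrm{id}\Rightarrow T$, $+:T_2\Rightarrow T$, $\ell:T\Rightarrow T^2$, $c:T^2\Rightarrow T^2$ are natural transformations, such that: 1. for every object $X$ and every $n\in\mathbb N$ the $n$-fold fibre power $T_nX=TX\times_X\cdots\times_X TX$ of $p_X:TX\to X$ exists, and it is preserved by every $T^k$, $k\in\mathbb N$ (write $\pi_1,\pi_2:T_2\Rightarrow T$ for the projections); 2. each $p_X:TX\to X$ is a commutative monoid in $\mathscr C_{/X}$ with addition $+_X$ and unit $0_X$; 3. $T(p_X)\circ\ell_X=0_X\circ p_X$, $\;\ell_X\circ +_X = +_{TX}\circ\langle \ell_X\circ\pi_1,\ell_X\circ\pi_2\rangle$, and $\ell_X\circ 0_X=0_{TX}\circ 0_X$; 4. $p_{TX}\circ c_X=T(p_X)$, $\;c_X\circ T(+_X)=+_{TX}\circ\langle c_X\circ T(\pi_1),c_X\circ T(\pi_2)\rangle$, and $c_X\circ T(0_X)=0_{TX}$;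 5. $c\circ c=\mathrm{id}_{T^2}$, $c\circ\ell=\ell$, and, writing $T\ast\alpha$ and $\alpha\ast T$ for the natural transformations with components $T(\alpha_X)$ and $\alpha_{TX}$, $(T\ast\ell)\circ\ell=(\ell\ast T)\circ\ell$, $\;(T\ast c)\circ(c\ast T)\circ(T\ast c)=(c\ast T)\circ(T\ast c)\circ(c\ast T)$, $\;(T\ast\ell)\circ c=(c\ast T)\circ(T\ast c)\circ(\ell\ast T)$; 6. for every $X$ the map $T(+_X)\circ\langle \ell_X\circ\pi_1,\,0_{TX}\circ\pi_2\rangle: T_2X\to T^2X$ is an equalizer of $T(p_X)$ and $0_X\circ p_X\circ p_{TX}: T^2X\to TX$, where $T(T_2X)$ is identified with $T^2X\times_{TX}T^2X$ (the fibre product along $T(p_X)$). (In 3 the map $\langle \ell_X\pi_1,\ell_X\pi_2\rangle:T_2X\to T_2(TX)$ makes sense because $p_{TX}\circ\ell_X=p_{TX}\circ c_X\circ\ell_X=T(p_X)\circ\ell_X=0_X\circ p_X$.) The category $\mathrm{Ind}(\mathscr C)$ has as objects the functors $\underline X=(X_i)_{i\in I}:I\to\mathscr C$ with $I$ a small filtered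 category, and $\mathrm{Ind}(\mathscr C)(\underline X,\underline Y)=\lim_{i}\operatorname{colim}_{j}\mathscr C(X_i,Y_j)$ with the evident composition. A functor $F:\mathscr C\to\mathscr D$ induces $\mathrm{Ind}(F):(X_i)\mapsto(FX_i)$, a natural transformation $\alpha:F\Rightarrow G$ induces $\mathrm{Ind}(\alpha)$ with $\mathrm{Ind}(\alpha)_{\underline X}=(\alpha_{X_i})_i$, and there are canonical levelwise identifications $\mathrm{Ind}(\mathrm{id})=\mathrm{id}$ and compositors $\phi_{F,G}:\mathrm{Ind}(G)\circ\mathrm{Ind}(F)\cong\mathrm{Ind}(G\circ F)$. **Theorem.** Let $(T,p,0,+,\ell,c)$ be a tangent structure on a category $\mathscr C$. Then all fibre powers $\mathrm{Ind}(T)_n\underline X$ of the maps $\mathrm{Ind}(p)_{\underline X}:\mathrm{Ind}(T)\underline X\to\underline X$ exist in $\mathrm{Ind}(\mathscr C)$, the canonical map $\theta=\langle\mathrm{Ind}(\pi_1),\mathrm{Ind}(\pi_2)\rangle:\mathrm{Ind}(T_2)\Rightarrow\mathrm{Ind}(T)_2$ is an isomorphism, and $$\bigl(\mathrm{Ind}(T),\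 \mathrm{Ind}(p),\ \mathrm{Ind}(0),\ \hat+,\ \hat\ell,\ \hat c\bigr)$$ is a tangent structure on $\mathrm{Ind}(\mathscr C)$, where $$\hat+=\mathrm{Ind}(+)\circ\theta^{-1},\qquad \hat\ell=\phi_{T,T}^{-1}\circ\mathrm{Ind}(\ell),\qquad \hat c=\phi_{T,T}^{-1}\circ\mathrm{Ind}(c)\circ\phi_{T,T}.$$ -/

import Mathlib

open CategoryTheory CategoryTheory.Limits Opposite

universe w v u v' u' v'' u''

/-! ### Tangent structures -/

section Tangent

variable {C : Type u} [Category.{v} C]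

/-- The compositional powers `T ^ k` of an endofunctor. -/
def iterFunctor (T : C ⥤ C) : ℕ → (C ⥤ C)
  | 0 => 𝟭 C
  | k + 1 => iterFunctor T k ⋙ T

/-- The diagram consisting of `n` copies of `p_X : T X ⟶ X`. -/
abbrev powerCospan {T : C ⥤ C} (p : T ⟶ 𝟭 C) (n : ℕ) (X : C) :
    WidePullbackShape (Fin n) ⥤ C :=
  WidePullbackShape.wideCospan X (fun _ : Fin n => T.obj X) (fun _ => p.app X)

/-- All pullback powers `T_n X = T X ×_X ⋯ ×_X T X` of all the maps `p_X : T X ⟶ X` exist. -/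
class HasPullbackPowers {T : C ⥤ C} (p : T ⟶ 𝟭 C) : Prop where
  hasLimit : ∀ (n : ℕ) (X : C), HasLimit (powerCospan p n X)

/-- The functors `T ^ k` preserve all pullback powers of the maps `p_X : T X ⟶ X`. -/
def PreservesPullbackPowers {T : C ⥤ C} (p : T ⟶ 𝟭 C) : Prop :=
  ∀ (k n : ℕ) (X : C), PreservesLimit (powerCospan p n X) (iterFunctor T k)

instance {T : C ⥤ C} (p : T ⟶ 𝟭 C) [h : HasPullbackPowers p] (n : ℕ) (X : C) :
    HasLimit (powerCospan p n X) :=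
  h.hasLimit n X

section Powers

variable {T : C ⥤ C} (p : T ⟶ 𝟭 C) [HasPullbackPowers p]

/-- The object `T_n X`. -/
noncomputable def powerObj (n : ℕ) (X : C) : C := limit (powerCospan p n X)

/-- The projections `T_n X ⟶ T X`. -/
noncomputable def powerProj (n : ℕ) (X : C) (i : Fin n) : powerObj p n X ⟶ T.obj X :=
  limit.π (powerCospan p n X) (some i)

/-- The structure map `T_n X ⟶ X`. -/
noncomputable def powerBase (n : ℕ) (X : C) : powerObj p n X ⟶ X :=
  limit.π (powerCospan p n X) none

lemma powerProj_p (n : ℕ) (X : C) (i : Fin n) :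
    powerProj p n X i ≫ p.app X = powerBase p n X :=
  limit.w (powerCospan p n X) (WidePullbackShape.Hom.term i)

lemma powerProj_p_assoc (n : ℕ) (X : C) (i : Fin n) {W : C} (f : X ⟶ W) :
    powerProj p n X i ≫ p.app X ≫ f = powerBase p n X ≫ f := by
  rw [← powerProj_p p n X i]; exact (Category.assoc _ _ _).symm

/-- The universal property of `T_n X`. -/
noncomputable def powerLift {n : ℕ} {X Z : C} (b : Z ⟶ X) (a : Fin n → (Z ⟶ T.obj X))
    (h : ∀ i, a i ≫ p.app X = b) : Z ⟶ powerObj p n X :=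
  limit.lift (powerCospan p n X) (WidePullbackShape.mkCone (F := powerCospan p n X) b a h)

@[simp]
lemma powerLift_proj {n : ℕ} {X Z : C} (b : Z ⟶ X) (a : Fin n → (Z ⟶ T.obj X))
    (h : ∀ i, a i ≫ p.app X = b) (i : Fin n) :
    powerLift p b a h ≫ powerProj p n X i = a i :=
  limit.lift_π _ _

@[simp]
lemma powerLift_base {n : ℕ} {X Z : C} (b : Z ⟶ X) (a : Fin n → (Z ⟶ T.obj X))
    (h : ∀ i, a i ≫ p.app X = b) :
    powerLift p b a h ≫ powerBase p n X = b :=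
  limit.lift_π _ _

lemma power_hom_ext {n : ℕ} {X Z : C} {f g : Z ⟶ powerObj p n X}
    (hb : f ≫ powerBase p n X = g ≫ powerBase p n X)
    (h : ∀ i, f ≫ powerProj p n X i = g ≫ powerProj p n X i) : f = g := by
  refine limit.hom_ext ?_
  rintro (_ | i)
  · exact hb
  · exact h i

/-- The functor `T_n : C ⥤ C`. -/
noncomputable def powerFunctor (n : ℕ) : C ⥤ C where
  obj X := powerObj p n X
  map {X Y} f := powerLift p (powerBase p n X ≫ f) (fun i => powerProj p n X i ≫ T.map f)
    (fun i => by
      have := p.naturality f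
      dsimp at this
      rw [Category.assoc, this, powerProj_p_assoc])
  map_id X := power_hom_ext p (by simp) (by simp)
  map_comp f g := power_hom_ext p
    (by rw [Category.assoc, powerLift_base, powerLift_base, ← Category.assoc, ← Category.assoc,
          powerLift_base])
    (fun i => by
      rw [Category.assoc, powerLift_proj, powerLift_proj, ← Category.assoc, powerLift_proj,
        Category.assoc, T.map_comp])

/-- The projections `π_i : T_n ⟶ T` as natural transformations. -/
noncomputable def powerπ (n : ℕ) (i : Fin n) : powerFunctor p n ⟶ T where
  app X := powerProj p n X i
  naturality _ _ _ := powerLift_proj p _ _ _ i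

variable {p}

lemma powerπ_p {n : ℕ} (i j : Fin n) (X : C) :
    (powerπ p n i).app X ≫ p.app X = (powerπ p n j).app X ≫ p.app X :=
  (powerProj_p p n X i).trans (powerProj_p p n X j).symm

lemma powerπ_p_assoc {n : ℕ} (i j : Fin n) (X : C) {W : C} (f : X ⟶ W) :
    (powerπ p n i).app X ≫ p.app X ≫ f = (powerπ p n j).app X ≫ p.app X ≫ f :=
  (powerProj_p_assoc p n X i f).trans (powerProj_p_assoc p n X j f).symm

/-- The map `⟨a, b⟩ : Z ⟶ T_2 X = T X ×_X T X`. -/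
noncomputable def pairLift {X Z : C} (a b : Z ⟶ T.obj X) (h : a ≫ p.app X = b ≫ p.app X) :
    Z ⟶ (powerFunctor p 2).obj X :=
  powerLift p (b ≫ p.app X) ![a, b] (fun i => by fin_cases i <;> simp [h])

@[simp]
lemma pairLift_fst {X Z : C} (a b : Z ⟶ T.obj X) (h : a ≫ p.app X = b ≫ p.app X) :
    pairLift a b h ≫ (powerπ p 2 0).app X = a :=
  powerLift_proj p _ _ _ 0

lemma pairLift_fst_assoc {X Z : C} (a b : Z ⟶ T.obj X) (h : a ≫ p.app X = b ≫ p.app X)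
    {W : C} (f : T.obj X ⟶ W) :
    pairLift a b h ≫ (powerπ p 2 0).app X ≫ f = a ≫ f := by
  rw [← Category.assoc, pairLift_fst]

@[simp]
lemma pairLift_snd {X Z : C} (a b : Z ⟶ T.obj X) (h : a ≫ p.app X = b ≫ p.app X) :
    pairLift a b h ≫ (powerπ p 2 1).app X = b :=
  powerLift_proj p _ _ _ 1

lemma pairLift_snd_assoc {X Z : C} (a b : Z ⟶ T.obj X) (h : a ≫ p.app X = b ≫ p.app X)
    {W : C} (f : T.obj X ⟶ W) :
    pairLift a b h ≫ (powerπ p 2 1).app X ≫ f = b ≫ f := by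
  rw [← Category.assoc, pairLift_snd]

/-- Since `T` preserves the pullback `T_2 X`, the object `T (T_2 X)` is the pullback
`T² X ×_{T X} T² X` of `T p_X` along itself; this is the induced map `⟨a, b⟩ : Z ⟶ T (T_2 X)`. -/
noncomputable def mapPairLift (hT : PreservesPullbackPowers p) {X Z : C}
    (a b : Z ⟶ T.obj (T.obj X)) (h : a ≫ T.map (p.app X) = b ≫ T.map (p.app X)) :
    Z ⟶ T.obj ((powerFunctor p 2).obj X) :=
  haveI : PreservesLimit (powerCospan p 2 X) T := hT 1 2 X
  (isLimitOfPreserves T (limit.isLimit (powerCospan p 2 X))).lift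
    (WidePullbackShape.mkCone (F := powerCospan p 2 X ⋙ T) (b ≫ T.map (p.app X))
      (fun i => (![a, b] : Fin 2 → (Z ⟶ T.obj (T.obj X))) i)
      (fun i => by
        change (![a, b] : Fin 2 → (Z ⟶ T.obj (T.obj X))) i ≫ T.map (p.app X) = _
        fin_cases i
        · exact h
        · rfl))

@[simp]
lemma mapPairLift_fst (hT : PreservesPullbackPowers p) {X Z : C}
    (a b : Z ⟶ T.obj (T.obj X)) (h : a ≫ T.map (p.app X) = b ≫ T.map (p.app X)) :
    mapPairLift hT a b h ≫ T.map ((powerπ p 2 0).app X) = a :=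
  haveI : PreservesLimit (powerCospan p 2 X) T := hT 1 2 X
  (isLimitOfPreserves T (limit.isLimit (powerCospan p 2 X))).fac _ (some (0 : Fin 2))

@[simp]
lemma mapPairLift_snd (hT : PreservesPullbackPowers p) {X Z : C}
    (a b : Z ⟶ T.obj (T.obj X)) (h : a ≫ T.map (p.app X) = b ≫ T.map (p.app X)) :
    mapPairLift hT a b h ≫ T.map ((powerπ p 2 1).app X) = b :=
  haveI : PreservesLimit (powerCospan p 2 X) T := hT 1 2 X
  (isLimitOfPreserves T (limit.isLimit (powerCospan p 2 X))).fac _ (some (1 : Fin 2))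

/-- Each `p_X : T X ⟶ X` is a commutative monoid in the slice category over `X`, with unit
`0_X` and addition `+_X : T_2 X ⟶ T X`. -/
structure IsAdditiveBundle (zero : 𝟭 C ⟶ T) (add : powerFunctor p 2 ⟶ T) : Prop where
  /-- the unit is a morphism over `X` -/
  zero_p : ∀ X : C, zero.app X ≫ p.app X = 𝟙 X
  /-- the addition is a morphism over `X` -/
  add_p : ∀ X : C, add.app X ≫ p.app X = (powerπ p 2 0).app X ≫ p.app X
  zero_add : ∀ X : C,
    pairLift (p := p) (p.app X ≫ zero.app X) (𝟙 (T.obj X))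
      ((Category.assoc _ _ _).trans
        (((congrArg (p.app X ≫ ·) (zero_p X)).trans (Category.comp_id _)).trans
          (Category.id_comp _).symm)) ≫ add.app X = 𝟙 (T.obj X)
  add_zero : ∀ X : C,
    pairLift (p := p) (𝟙 (T.obj X)) (p.app X ≫ zero.app X)
      ((Category.assoc _ _ _).trans
        (((congrArg (p.app X ≫ ·) (zero_p X)).trans (Category.comp_id _)).trans
          (Category.id_comp _).symm)).symm ≫ add.app X = 𝟙 (T.obj X)
  add_comm : ∀ X : C,
    pairLift (p := p) ((powerπ p 2 1).app X) ((powerπ p 2 0).app X) (powerπ_p 1 0 X) ≫ add.app X =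
      add.app X
  add_assoc : ∀ X : C,
    pairLift (p := p)
        (pairLift (p := p) ((powerπ p 3 0).app X) ((powerπ p 3 1).app X) (powerπ_p 0 1 X) ≫ add.app X)
        ((powerπ p 3 2).app X)
        (by rw [Category.assoc, add_p, pairLift_fst_assoc, powerπ_p 0 2]) ≫ add.app X =
      pairLift (p := p) ((powerπ p 3 0).app X)
        (pairLift (p := p) ((powerπ p 3 1).app X) ((powerπ p 3 2).app X) (powerπ_p 1 2 X) ≫ add.app X)
        (by rw [Category.assoc, add_p, pairLift_fst_assoc, powerπ_p 0 1]) ≫ add.app X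

/-- `(T, p, 0, +, ℓ, c)` is a tangent structure on `C`. The map
`⟨ℓ_X ∘ π₁, ℓ_X ∘ π₂⟩ : T_2 X ⟶ T_2 (T X)` in `lift_add` is well defined because
`p_{T X} ∘ ℓ_X = p_{T X} ∘ c_X ∘ ℓ_X = T p_X ∘ ℓ_X = 0_X ∘ p_X`. -/
structure IsTangentStructure (T : C ⥤ C) (p : T ⟶ 𝟭 C) [HasPullbackPowers p]
    (zero : 𝟭 C ⟶ T) (add : powerFunctor p 2 ⟶ T)
    (lift : T ⟶ T ⋙ T) (flip : T ⋙ T ⟶ T ⋙ T) : Prop where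
  /-- the powers of `T` preserve the pullback powers of `p` -/
  preserves : PreservesPullbackPowers p
  /-- `p` is an additive bundle -/
  additive : IsAdditiveBundle (p := p) zero add
  /-- `(c_X, id)` is a bundle morphism: projections -/
  flip_p : ∀ X : C, flip.app X ≫ p.app (T.obj X) = T.map (p.app X)
  /-- `(c_X, id)` is a bundle morphism: additions -/
  flip_add : ∀ X : C,
    T.map (add.app X) ≫ flip.app X =
      pairLift (p := p) (X := T.obj X)
        (T.map ((powerπ p 2 0).app X) ≫ flip.app X) (T.map ((powerπ p 2 1).app X) ≫ flip.app X)
        (by rw [Category.assoc, Category.assoc, flip_p, ← T.map_comp, ← T.map_comp,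
              powerπ_p 0 1]) ≫
        add.app (T.obj X)
  /-- `(c_X, id)` is a bundle morphism: zeros -/
  flip_zero : ∀ X : C, T.map (zero.app X) ≫ flip.app X = zero.app (T.obj X)
  /-- `c ∘ c = id` -/
  flip_flip : ∀ X : C, flip.app X ≫ flip.app X = 𝟙 (T.obj (T.obj X))
  /-- `c ∘ ℓ = ℓ` -/
  lift_flip : ∀ X : C, lift.app X ≫ flip.app X = lift.app X
  /-- `(T ∗ ℓ) ∘ ℓ = (ℓ ∗ T) ∘ ℓ` -/
  lift_lift : ∀ X : C, lift.app X ≫ T.map (lift.app X) = lift.app X ≫ lift.app (T.obj X)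
  /-- `(T ∗ c) ∘ (c ∗ T) ∘ (T ∗ c) = (c ∗ T) ∘ (T ∗ c) ∘ (c ∗ T)` -/
  flip_braid : ∀ X : C,
    T.map (flip.app X) ≫ flip.app (T.obj X) ≫ T.map (flip.app X) =
      flip.app (T.obj X) ≫ T.map (flip.app X) ≫ flip.app (T.obj X)
  /-- `(T ∗ ℓ) ∘ c = (c ∗ T) ∘ (T ∗ c) ∘ (ℓ ∗ T)` -/
  flip_lift : ∀ X : C,
    flip.app X ≫ T.map (lift.app X) =
      lift.app (T.obj X) ≫ T.map (flip.app X) ≫ flip.app (T.obj X)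
  /-- `(ℓ_X, 0_X)` is a bundle morphism: projections -/
  lift_p : ∀ X : C, lift.app X ≫ T.map (p.app X) = p.app X ≫ zero.app X
  /-- `(ℓ_X, 0_X)` is a bundle morphism: additions -/
  lift_add : ∀ X : C,
    add.app X ≫ lift.app X =
      pairLift (p := p) (X := T.obj X)
        ((powerπ p 2 0).app X ≫ lift.app X) ((powerπ p 2 1).app X ≫ lift.app X)
        (by rw [← lift_flip, Category.assoc, Category.assoc, Category.assoc, Category.assoc,
              flip_p, lift_p]; exact powerπ_p_assoc 0 1 X _) ≫
        add.app (T.obj X)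
  /-- `(ℓ_X, 0_X)` is a bundle morphism: zeros -/
  lift_zero : ∀ X : C, zero.app X ≫ lift.app X = zero.app X ≫ zero.app (T.obj X)
  /-- universality of the vertical lift -/
  universal : ∀ X : C,
    ∃ w : (mapPairLift preserves (X := X)
          ((powerπ p 2 0).app X ≫ lift.app X) ((powerπ p 2 1).app X ≫ zero.app (T.obj X))
          (by
            have h := zero.naturality (p.app X)
            dsimp at h
            rw [Category.assoc, Category.assoc, lift_p, ← h]
            exact powerπ_p_assoc 0 1 X _) ≫ T.map (add.app X)) ≫ T.map (p.app X) =
        (mapPairLift preserves (X := X)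
          ((powerπ p 2 0).app X ≫ lift.app X) ((powerπ p 2 1).app X ≫ zero.app (T.obj X)) _ ≫
            T.map (add.app X)) ≫ (p.app (T.obj X) ≫ p.app X ≫ zero.app X),
      Nonempty (IsLimit (Fork.ofι _ w))

end Powers

end Tangent

/-! ### The ind-category -/

/-- An ind-object of `C`: a functor `F : I ⥤ C` with `I` a small filtered category. -/
structure IndCat (C : Type u) [Category.{v} C] : Type (max u v (w + 1)) where
  I : Type w
  [cat : SmallCategory I]
  [filtered : IsFiltered I]
  F : I ⥤ C

namespace IndCat

attribute [instance] IndCat.cat IndCat.filtered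

section

variable {C : Type u} [Category.{v} C]

/-- `colim_j C(A, Y_j)`. -/
abbrev Germ (A : C) (Y : IndCat.{w} C) : Type (max w v) :=
  (Y.F ⋙ coyoneda.obj (op A)).ColimitType

/-- The class of `a : A ⟶ Y_j` in `colim_j C(A, Y_j)`. -/
def germ {A : C} {Y : IndCat.{w} C} (j : Y.I) (a : A ⟶ Y.F.obj j) : Germ A Y :=
  (Y.F ⋙ coyoneda.obj (op A)).ιColimitType j a

lemma germ_ind {A : C} {Y : IndCat.{w} C} (t : Germ A Y) :
    ∃ (j : Y.I) (a : A ⟶ Y.F.obj j), germ j a = t :=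
  Functor.ιColimitType_jointly_surjective _ t

lemma germ_map {A : C} {Y : IndCat.{w} C} {j j' : Y.I} (g : j ⟶ j') (a : A ⟶ Y.F.obj j) :
    germ j' (a ≫ Y.F.map g) = germ j a :=
  Functor.ιColimitType_map (Y.F ⋙ coyoneda.obj (op A)) g a

/-- Maps out of `colim_j C(A, Y_j)`. -/
def Germ.desc {A : C} {Y : IndCat.{w} C} {S : Type*} (φ : ∀ j : Y.I, (A ⟶ Y.F.obj j) → S)
    (hφ : ∀ {j j' : Y.I} (g : j ⟶ j') (a : A ⟶ Y.F.obj j), φ j' (a ≫ Y.F.map g) = φ j a)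
    (t : Germ A Y) : S :=
  Quot.lift (fun x : Σ j : Y.I, (A ⟶ Y.F.obj j) => φ x.1 x.2)
    (by rintro ⟨j, a⟩ ⟨j', a'⟩ ⟨g, h⟩; exact (hφ g a).symm.trans (congrArg (φ j') h.symm)) t

@[simp]
lemma Germ.desc_germ {A : C} {Y : IndCat.{w} C} {S : Type*}
    (φ : ∀ j : Y.I, (A ⟶ Y.F.obj j) → S)
    (hφ : ∀ {j j' : Y.I} (g : j ⟶ j') (a : A ⟶ Y.F.obj j), φ j' (a ≫ Y.F.map g) = φ j a)
    (j : Y.I) (a : A ⟶ Y.F.obj j) : Germ.desc φ hφ (germ j a) = φ j a := rfl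

/-- The map `colim_j C(B, Y_j) ⟶ colim_j C(A, Y_j)` given by precomposition with `f : A ⟶ B`. -/
def Germ.precomp {A B : C} {Y : IndCat.{w} C} (f : A ⟶ B) (t : Germ B Y) : Germ A Y :=
  t.desc (fun j b => germ j (f ≫ b))
    (fun g b => by rw [← Category.assoc]; exact germ_map g (f ≫ b))

@[simp]
lemma Germ.precomp_germ {A B : C} {Y : IndCat.{w} C} (f : A ⟶ B) (j : Y.I)
    (b : B ⟶ Y.F.obj j) : (germ j b : Germ B Y).precomp f = germ j (f ≫ b) := rfl

lemma Germ.precomp_id {A : C} {Y : IndCat.{w} C} (t : Germ A Y) : t.precomp (𝟙 A) = t := by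
  obtain ⟨j, a, rfl⟩ := germ_ind t
  simp

lemma Germ.precomp_comp {A B D : C} {Y : IndCat.{w} C} (f : A ⟶ B) (g : B ⟶ D) (t : Germ D Y) :
    t.precomp (f ≫ g) = (t.precomp g).precomp f := by
  obtain ⟨j, a, rfl⟩ := germ_ind t
  simp

/-- A morphism `X ⟶ Y` of ind-objects: an element of `lim_i colim_j C(X_i, Y_j)`. -/
@[ext]
structure Hom (X Y : IndCat.{w} C) : Type (max w v) where
  val : ∀ i : X.I, Germ (X.F.obj i) Y
  compat : ∀ {i i' : X.I} (f : i ⟶ i'), (val i').precomp (X.F.map f) = val i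

/-- Postcomposition of a class in `colim_j C(A, Y_j)` with a morphism of ind-objects. -/
def Germ.comp {A : C} {Y Z : IndCat.{w} C} (t : Germ A Y) (g : Hom Y Z) : Germ A Z :=
  t.desc (fun j a => (g.val j).precomp a)
    (fun f a => by rw [Germ.precomp_comp, g.compat])

@[simp]
lemma Germ.germ_comp {A : C} {Y Z : IndCat.{w} C} (j : Y.I) (a : A ⟶ Y.F.obj j) (g : Hom Y Z) :
    (germ j a : Germ A Y).comp g = (g.val j).precomp a := rfl

lemma Germ.precomp_comp_hom {A B : C} {Y Z : IndCat.{w} C} (f : A ⟶ B) (t : Germ B Y)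
    (g : Hom Y Z) : (t.precomp f).comp g = (t.comp g).precomp f := by
  obtain ⟨j, a, rfl⟩ := germ_ind t
  simp [Germ.precomp_comp]

/-- A natural transformation between functors on the same index category. -/
def homOfNatTrans {I : Type w} [SmallCategory I] [IsFiltered I] {F G : I ⥤ C} (ρ : F ⟶ G) :
    Hom (IndCat.mk I F) (IndCat.mk I G) where
  val i := germ (Y := IndCat.mk I G) i (ρ.app i)
  compat {i i'} f := by
    rw [Germ.precomp_germ, ρ.naturality]
    exact germ_map (Y := IndCat.mk I G) f (ρ.app i)

instance : Category.{max w v} (IndCat.{w} C) where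
  Hom := Hom
  id X := homOfNatTrans (𝟙 X.F)
  comp f g :=
    { val := fun i => (f.val i).comp g
      compat := fun h => by rw [← Germ.precomp_comp_hom, f.compat] }
  id_comp f := by
    ext i
    exact Germ.precomp_id _
  comp_id {X Y} f := by
    ext i
    change (f.val i).comp (homOfNatTrans (𝟙 Y.F)) = f.val i
    obtain ⟨j, a, h⟩ := germ_ind (f.val i)
    rw [← h]
    exact congrArg (germ (Y := Y) j) (Category.comp_id a)
  assoc f g h := by
    ext i
    change ((f.val i).comp g).comp h = (f.val i).comp _
    obtain ⟨j, a, e⟩ := germ_ind (f.val i)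
    rw [← e]
    exact Germ.precomp_comp_hom a (g.val j) h

@[ext]
lemma hom_ext {X Y : IndCat.{w} C} {f g : X ⟶ Y} (h : ∀ i, Hom.val f i = Hom.val g i) : f = g :=
  Hom.ext (funext h)

@[simp]
lemma comp_val {X Y Z : IndCat.{w} C} (f : X ⟶ Y) (g : Y ⟶ Z) (i : X.I) :
    Hom.val (f ≫ g) i = (Hom.val f i).comp g := rfl

/-- A natural transformation of functors on the same index category, as a morphism of
`Ind(C)`. -/
def levelMap {I : Type w} [SmallCategory I] [IsFiltered I] {F G : I ⥤ C} (ρ : F ⟶ G) :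
    IndCat.mk I F ⟶ IndCat.mk I G :=
  homOfNatTrans ρ

@[simp]
lemma levelMap_val {I : Type w} [SmallCategory I] [IsFiltered I] {F G : I ⥤ C} (ρ : F ⟶ G)
    (i : I) : Hom.val (levelMap ρ) i = germ (Y := IndCat.mk I G) i (ρ.app i) := rfl

lemma levelMap_id {I : Type w} [SmallCategory I] [IsFiltered I] (F : I ⥤ C) :
    levelMap (𝟙 F) = 𝟙 (IndCat.mk I F) := rfl

lemma levelMap_comp {I : Type w} [SmallCategory I] [IsFiltered I] {F G H : I ⥤ C}
    (ρ : F ⟶ G) (σ : G ⟶ H) : levelMap (ρ ≫ σ) = levelMap ρ ≫ levelMap σ := rfl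

/-- A natural isomorphism of functors on the same index category, as an isomorphism of
`Ind(C)`. -/
def levelIso {I : Type w} [SmallCategory I] [IsFiltered I] {F G : I ⥤ C} (ρ : F ≅ G) :
    IndCat.mk I F ≅ IndCat.mk I G where
  hom := levelMap ρ.hom
  inv := levelMap ρ.inv
  hom_inv_id := by rw [← levelMap_comp, ρ.hom_inv_id, levelMap_id]
  inv_hom_id := by rw [← levelMap_comp, ρ.inv_hom_id, levelMap_id]

end

section Functoriality

variable {C : Type u} [Category.{v} C] {D : Type u'} [Category.{v'} D]
  {E : Type u''} [Category.{v''} E]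

/-- The object `(F X_i)_i`. -/
abbrev mapObj (F : C ⥤ D) (X : IndCat.{w} C) : IndCat.{w} D := IndCat.mk X.I (X.F ⋙ F)

/-- The map `colim_j C(A, Y_j) ⟶ colim_j D(F A, F Y_j)` induced by `F`. -/
def Germ.map (F : C ⥤ D) {A : C} {Y : IndCat.{w} C} (t : Germ A Y) :
    Germ (F.obj A) (mapObj F Y) :=
  Germ.desc (A := A) (Y := Y)
    (fun (j : Y.I) (a : A ⟶ Y.F.obj j) => germ (A := F.obj A) (Y := mapObj F Y) j (F.map a))
    (fun g a => by rw [F.map_comp]; exact germ_map (Y := mapObj F Y) g (F.map a)) t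

@[simp]
lemma Germ.map_germ (F : C ⥤ D) {A : C} {Y : IndCat.{w} C} (j : Y.I) (a : A ⟶ Y.F.obj j) :
    (germ j a : Germ A Y).map F = germ (Y := mapObj F Y) j (F.map a) := rfl

lemma Germ.map_precomp (F : C ⥤ D) {A B : C} {Y : IndCat.{w} C} (f : A ⟶ B) (t : Germ B Y) :
    (t.precomp f).map F = (t.map F).precomp (F.map f) := by
  obtain ⟨j, a, rfl⟩ := germ_ind t
  simp

/-- The functor `Ind(F) : Ind(C) ⥤ Ind(D)`. -/
def map (F : C ⥤ D) : IndCat.{w} C ⥤ IndCat.{w} D where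
  obj X := mapObj F X
  map {X Y} f :=
    { val := fun i => (Hom.val f i).map F
      compat := fun {i i'} h => by
        have := congrArg (Germ.map F) (Hom.compat f h)
        rw [Germ.map_precomp] at this
        exact this }
  map_id X := by
    ext i
    exact congrArg (germ (Y := mapObj F X) i) (F.map_id _)
  map_comp {X Y Z} f g := by
    ext i
    change ((Hom.val f i).comp g).map F = ((Hom.val f i).map F).comp _
    obtain ⟨j, a, h⟩ := germ_ind (Hom.val f i)
    rw [← h]
    exact Germ.map_precomp F a (Hom.val g j)

/-- The natural transformation `Ind(α) : Ind(F) ⟶ Ind(G)`, with components `(α_{X_i})_i`. -/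
def mapNat {F G : C ⥤ D} (α : F ⟶ G) : map.{w} F ⟶ map.{w} G where
  app X := levelMap (Functor.whiskerLeft X.F α)
  naturality X Y f := by
    ext i
    change ((Hom.val f i).map F).comp _ = Germ.precomp (α.app (X.F.obj i)) ((Hom.val f i).map G)
    obtain ⟨j, a, h⟩ := germ_ind (Hom.val f i)
    rw [← h]
    exact congrArg (germ (Y := mapObj G Y) j) (α.naturality a)

variable (C) in
/-- The identification `Ind(id) = id`. -/
def mapId : map.{w} (𝟭 C) ≅ 𝟭 (IndCat.{w} C) :=
  NatIso.ofComponents (fun X => levelIso X.F.rightUnitor) (fun {X Y} f => by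
    ext i
    change ((Hom.val f i).map (𝟭 C)).comp _ = Germ.precomp (𝟙 (X.F.obj i)) (Hom.val f i)
    obtain ⟨j, a, h⟩ := germ_ind (Hom.val f i)
    rw [← h]
    exact congrArg (germ (Y := Y) j) ((Category.comp_id a).trans (Category.id_comp a).symm))

/-- The compositor isomorphism `Ind(G) ∘ Ind(F) ≅ Ind(G ∘ F)`. -/
def mapComp (F : C ⥤ D) (G : D ⥤ E) : map.{w} F ⋙ map.{w} G ≅ map.{w} (F ⋙ G) :=
  NatIso.ofComponents (fun X => levelIso (Functor.associator X.F F G)) (fun {X Y} f => by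
    ext i
    change (((Hom.val f i).map F).map G).comp _ =
      Germ.precomp (𝟙 (G.obj (F.obj (X.F.obj i)))) ((Hom.val f i).map (F ⋙ G))
    obtain ⟨j, a, h⟩ := germ_ind (Hom.val f i)
    rw [← h]
    exact congrArg (germ (Y := mapObj (F ⋙ G) Y) j)
      ((Category.comp_id _).trans (Category.id_comp _).symm))

end Functoriality

/-! ### The induced tangent structure on the ind-category -/

section IndTangent

variable {C : Type u} [Category.{v} C] {T : C ⥤ C}

/-- `Ind(p) : Ind(T) ⟶ Ind(id) = id`. -/
def indP (p : T ⟶ 𝟭 C) : map.{w} T ⟶ 𝟭 (IndCat.{w} C) := mapNat p ≫ (mapId C).hom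

/-- `Ind(0) : id = Ind(id) ⟶ Ind(T)`. -/
def indZero (zero : 𝟭 C ⟶ T) : 𝟭 (IndCat.{w} C) ⟶ map.{w} T := (mapId C).inv ≫ mapNat zero

/-- The vertical lift `Ind(T) ⟶ Ind(T²) ≅ Ind(T)²`. -/
def indLift (lift : T ⟶ T ⋙ T) : map.{w} T ⟶ map.{w} T ⋙ map.{w} T :=
  mapNat lift ≫ (mapComp T T).inv

/-- The canonical flip `Ind(T)² ≅ Ind(T²) ⟶ Ind(T²) ≅ Ind(T)²`. -/
def indFlip (flip : T ⋙ T ⟶ T ⋙ T) : map.{w} T ⋙ map.{w} T ⟶ map.{w} T ⋙ map.{w} T :=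
  (mapComp T T).hom ≫ mapNat flip ≫ (mapComp T T).inv

lemma mapNat_comp {D : Type u'} [Category.{v'} D] {F G H : C ⥤ D} (α : F ⟶ G) (β : G ⟶ H) :
    mapNat.{w} (α ≫ β) = mapNat α ≫ mapNat β := rfl

lemma powerComparison_w (p : T ⟶ 𝟭 C) [HasPullbackPowers p] (i j : Fin 2) (X : IndCat.{w} C) :
    (mapNat (powerπ p 2 i)).app X ≫ (indP p).app X =
      (mapNat (powerπ p 2 j)).app X ≫ (indP p).app X := by
  have h : powerπ p 2 i ≫ p = powerπ p 2 j ≫ p := by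
    ext Y
    exact powerπ_p i j Y
  have h' := congrArg (fun α => (mapNat.{w} α).app X ≫ (mapId C).hom.app X) h
  simpa [indP, mapNat_comp] using h'

/-- The canonical comparison map `⟨Ind(π₁), Ind(π₂)⟩ : Ind(T_2) ⟶ Ind(T)_2`. -/
noncomputable def powerComparison (p : T ⟶ 𝟭 C) [HasPullbackPowers p]
    [HasPullbackPowers (indP.{w} p)] :
    map.{w} (powerFunctor p 2) ⟶ powerFunctor (indP.{w} p) 2 where
  app X := pairLift (p := indP.{w} p) ((mapNat (powerπ p 2 0)).app X) ((mapNat (powerπ p 2 1)).app X)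
    (powerComparison_w p 0 1 X)
  naturality X Y f := by
    have key : ∀ k : Fin 2, ((map.{w} (powerFunctor p 2)).map f ≫
        pairLift (p := indP.{w} p) ((mapNat (powerπ p 2 0)).app Y) ((mapNat (powerπ p 2 1)).app Y)
          (powerComparison_w p 0 1 Y)) ≫ (powerπ (indP.{w} p) 2 k).app Y =
        (pairLift (p := indP.{w} p) ((mapNat (powerπ p 2 0)).app X) ((mapNat (powerπ p 2 1)).app X)
          (powerComparison_w p 0 1 X) ≫ (powerFunctor (indP.{w} p) 2).map f) ≫
          (powerπ (indP.{w} p) 2 k).app Y := by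
      intro k
      rw [Category.assoc, Category.assoc, (powerπ (indP.{w} p) 2 k).naturality]
      fin_cases k
      · exact ((congrArg ((map.{w} (powerFunctor p 2)).map f ≫ ·) (pairLift_fst _ _ _)).trans
          ((mapNat (powerπ p 2 0)).naturality f)).trans (pairLift_fst_assoc _ _ _ _).symm
      · exact ((congrArg ((map.{w} (powerFunctor p 2)).map f ≫ ·) (pairLift_snd _ _ _)).trans
          ((mapNat (powerπ p 2 1)).naturality f)).trans (pairLift_snd_assoc _ _ _ _).symm
    refine power_hom_ext _ ?_ key
    rw [← powerProj_p _ 2 Y 0]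
    exact (Category.assoc _ _ _).symm.trans
      ((congrArg (· ≫ (indP.{w} p).app Y) (key 0)).trans (Category.assoc _ _ _))

/-- The addition `Ind(T)_2 ≅ Ind(T_2) ⟶ Ind(T)`. -/
noncomputable def indAdd (p : T ⟶ 𝟭 C) [HasPullbackPowers p] [HasPullbackPowers (indP.{w} p)]
    [IsIso (powerComparison.{w} p)] (add : powerFunctor p 2 ⟶ T) :
    powerFunctor (indP.{w} p) 2 ⟶ map.{w} T :=
  inv (powerComparison p) ≫ mapNat add

end IndTangent

end IndCat

/-! All the structure maps on $\mathrm{Ind}(\mathscr C)$ are levelwise: over an ind-object with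
index category $I$, each is represented by a natural transformation of functors $I\to\mathscr C$.
Sending such a transformation to its morphism of ind-objects (`levelMap`) respects composition, so
an identity that holds at every level of $\mathscr C$ holds in $\mathrm{Ind}(\mathscr C)$. This
settles the purely equational axioms.

The content lies in the limits. Since $\mathrm{Ind}(\mathscr C)(\underline Z,\underline
Y)=\lim_i\operatorname{colim}_j\mathscr C(Z_i,Y_j)$ and filtered colimits of sets commute with
finite limits, a levelwise finite wide pullback or equalizer is one in $\mathrm{Ind}(\mathscr C)$
(`isWidePullback_levelMap`, `isEqualizerMap_levelMap`). Only the limits in question need exist in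
$\mathscr C$. Hence $\mathrm{Ind}(T_n)\underline X$ is the $n$-th fibre power of
$\mathrm{Ind}(p)_{\underline X}$, and $\mathrm{Ind}(F)$ preserves it whenever $F$ preserves the
fibre powers of $p$. With $F=T^k$ this gives preservation, and $n=2$ shows that $\theta$ is
invertible.

The chosen power $\mathrm{Ind}(T)_n\underline X$ is only isomorphic to the levelwise one. Axioms
with this source are therefore checked after precomposing with `levelPowerIso`, where pairings
followed by $\hat+$ become levelwise (`comp_pairLift_indAdd`, `comp_mapPairLift_indAdd`).
Universality of the vertical lift then reduces to a levelwise equalizer. -/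

section LimitPredicates

/-! ### Wide pullbacks and equalizers as existence-and-uniqueness statements -/

variable {E : Type u} [Category.{v} E]

/-- `P`, with the maps `b` and `a j`, is the wide pullback of the maps `q j : A j ⟶ B`. -/
structure IsWidePullback {J : Type*} {P B : E} {A : J → E} (q : ∀ j, A j ⟶ B) (b : P ⟶ B)
    (a : ∀ j, P ⟶ A j) : Prop where
  w : ∀ j, a j ≫ q j = b
  existsUnique : ∀ {Z : E} (b' : Z ⟶ B) (a' : ∀ j, Z ⟶ A j), (∀ j, a' j ≫ q j = b') →
    ∃! l : Z ⟶ P, l ≫ b = b' ∧ ∀ j, l ≫ a j = a' j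

lemma IsWidePullback.hom_ext {J : Type*} {P B : E} {A : J → E} {q : ∀ j, A j ⟶ B} {b : P ⟶ B}
    {a : ∀ j, P ⟶ A j} (h : IsWidePullback q b a) {Z : E} {f g : Z ⟶ P}
    (hb : f ≫ b = g ≫ b) (ha : ∀ j, f ≫ a j = g ≫ a j) : f = g :=
  (h.existsUnique (g ≫ b) (fun j => g ≫ a j) (fun j => by rw [Category.assoc, h.w])).unique
    ⟨hb, ha⟩ ⟨rfl, fun _ => rfl⟩

lemma isWidePullback_of_isLimit {J : Type w} {D : WidePullbackShape J ⥤ E} {c : Cone D}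
    (hc : IsLimit c) :
    IsWidePullback (fun j => D.map (WidePullbackShape.Hom.term j)) (c.π.app none)
      (fun j => c.π.app (some j)) where
  w j := c.w (WidePullbackShape.Hom.term j)
  existsUnique {Z} b' a' h := by
    refine ⟨hc.lift (WidePullbackShape.mkCone (F := D) b' a' h),
      ⟨hc.fac _ none, fun j => hc.fac _ (some j)⟩, ?_⟩
    rintro l ⟨hb, ha⟩
    refine hc.hom_ext ?_
    rintro (_ | j)
    · exact hb.trans (hc.fac (WidePullbackShape.mkCone (F := D) b' a' h) none).symm
    · exact (ha j).trans (hc.fac (WidePullbackShape.mkCone (F := D) b' a' h) (some j)).symm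

lemma nonempty_isLimit_of_isWidePullback {J : Type w} {D : WidePullbackShape J ⥤ E} {c : Cone D}
    (h : IsWidePullback (fun j => D.map (WidePullbackShape.Hom.term j)) (c.π.app none)
      (fun j => c.π.app (some j))) : Nonempty (IsLimit c) := by
  have key (s : Cone D) := h.existsUnique (s.π.app none) (fun j => s.π.app (some j))
    (fun j => s.w (WidePullbackShape.Hom.term j))
  refine ⟨{ lift := fun s => (key s).choose, fac := ?_, uniq := ?_ }⟩
  · rintro s (_ | j)
    · exact (key s).choose_spec.1.1
    · exact (key s).choose_spec.1.2 j
  · intro s m hm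
    exact (key s).choose_spec.2 m ⟨hm none, fun j => hm (some j)⟩

/-- `ι` is the equalizer of `f` and `g`. -/
structure IsEqualizerMap {P A B : E} (f g : A ⟶ B) (ι : P ⟶ A) : Prop where
  w : ι ≫ f = ι ≫ g
  existsUnique : ∀ {Z : E} (a : Z ⟶ A), a ≫ f = a ≫ g → ∃! l : Z ⟶ P, l ≫ ι = a

lemma IsEqualizerMap.hom_ext {P A B : E} {f g : A ⟶ B} {ι : P ⟶ A} (h : IsEqualizerMap f g ι)
    {Z : E} {x y : Z ⟶ P} (e : x ≫ ι = y ≫ ι) : x = y :=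
  (h.existsUnique (y ≫ ι) (by rw [Category.assoc, h.w, Category.assoc])).unique e rfl

lemma isEqualizerMap_iff {P A B : E} {f g : A ⟶ B} {ι : P ⟶ A} :
    IsEqualizerMap f g ι ↔ ∃ w : ι ≫ f = ι ≫ g, Nonempty (IsLimit (Fork.ofι ι w)) := by
  constructor
  · intro h
    refine ⟨h.w, ⟨Fork.IsLimit.mk' _ fun s => ?_⟩⟩
    have k := h.existsUnique s.ι s.condition
    exact ⟨k.choose, k.choose_spec.1, fun {m} hm => k.choose_spec.2 m hm⟩
  · rintro ⟨w, ⟨hl⟩⟩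
    refine ⟨w, fun {Z} a h => ⟨hl.lift (Fork.ofι a h), hl.fac (Fork.ofι a h) .zero, ?_⟩⟩
    intro y hy
    exact Fork.IsLimit.hom_ext hl (hy.trans (hl.fac (Fork.ofι a h) .zero).symm)

/-- Needed to pass from the levelwise $\mathrm{Ind}(T_2)\underline X$ to the chosen power
$\mathrm{Ind}(T)_2\underline X$ as the source of the vertical lift. -/
lemma IsEqualizerMap.comp_iso {P Q A B : E} {f g : A ⟶ B} {ι : P ⟶ A}
    (h : IsEqualizerMap f g ι) (e : Q ⟶ P) [IsIso e] : IsEqualizerMap f g (e ≫ ι) where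
  w := by rw [Category.assoc, h.w, Category.assoc]
  existsUnique a ha := by
    obtain ⟨l, hl, -⟩ := h.existsUnique a ha
    refine ⟨l ≫ inv e, by simp [hl], fun y hy => ?_⟩
    rw [← cancel_mono e]
    exact h.hom_ext (by simp [hy, hl])

end LimitPredicates

/-! ### Levelwise finite limits are limits in the ind-category -/

namespace IndCat

section

variable {C : Type u} [Category.{v} C]

lemma germ_eq_iff {A : C} {Y : IndCat.{w} C} {j : Y.I} {a a' : A ⟶ Y.F.obj j} :
    germ j a = germ j a' ↔ ∃ (k : Y.I) (g : j ⟶ k), a ≫ Y.F.map g = a' ≫ Y.F.map g :=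
  Functor.ιColimitType_eq_iff_of_isFiltered' (Y.F ⋙ coyoneda.obj (op A)) a a'

lemma exists_common_germ {A : C} {Y : IndCat.{w} C} (s t : Germ A Y) :
    ∃ (k : Y.I) (a b : A ⟶ Y.F.obj k), germ k a = s ∧ germ k b = t := by
  obtain ⟨i, a, rfl⟩ := germ_ind s
  obtain ⟨j, b, rfl⟩ := germ_ind t
  exact ⟨IsFiltered.max i j, a ≫ Y.F.map (IsFiltered.leftToMax i j),
    b ≫ Y.F.map (IsFiltered.rightToMax i j), germ_map _ _, germ_map _ _⟩

/-- Finitely many indices have a common upper bound. The extra index `i` allows a base map already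
represented at `i` to be moved to the same stage. -/
lemma exists_common_germs {J : Type*} [Finite J] {A : C} {Y : IndCat.{w} C} (i : Y.I)
    (t : J → Germ A Y) :
    ∃ (k : Y.I) (_ : i ⟶ k) (a : J → (A ⟶ Y.F.obj k)), ∀ j, germ k (a j) = t j := by
  choose m a ha using fun j => germ_ind (t j)
  cases nonempty_fintype J
  classical
  obtain ⟨k, hk⟩ := IsFiltered.sup_objs_exists (insert i (Finset.univ.image m))
  have g (j : J) : m j ⟶ k := (hk (by simp)).some
  exact ⟨k, (hk (by simp)).some, fun j => a j ≫ Y.F.map (g j), fun j => by rw [germ_map, ha]⟩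

/-- Each equality of germs is witnessed by its own arrow out of `i`; filteredness completes these
finitely many arrows to a single one that witnesses all of them. -/
lemma exists_map_eq {J : Type*} [Finite J] {A : C} {Y : IndCat.{w} C} {i : Y.I}
    {a a' : J → (A ⟶ Y.F.obj i)} (h : ∀ j, germ i (a j) = germ i (a' j)) :
    ∃ (k : Y.I) (g : i ⟶ k), ∀ j, a j ≫ Y.F.map g = a' j ≫ Y.F.map g := by
  choose m g hg using fun j => germ_eq_iff.1 (h j)
  obtain ⟨k, s, f, hf⟩ := IsFiltered.wideSpan g
  refine ⟨k, s, fun j => ?_⟩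
  rw [← hf j, Y.F.map_comp, ← Category.assoc, hg, Category.assoc]

variable {I : Type w} [SmallCategory I] [IsFiltered I]

lemma germ_comp_levelMap {A : C} {F G : I ⥤ C} (ρ : F ⟶ G) (i : I) (a : A ⟶ F.obj i) :
    (germ (Y := IndCat.mk I F) i a).comp (levelMap ρ) =
      germ (Y := IndCat.mk I G) i (a ≫ ρ.app i) := rfl

/-- The commutation of filtered colimits with finite wide pullbacks in sets, applied to
$j\mapsto\mathscr C(X,-_j)$. Finiteness of `J` lets all data and all equations be realized at one
stage. -/
theorem existsUnique_germ_of_isWidePullback {J : Type*} [Finite J] {P A B : I ⥤ C} {q : A ⟶ B}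
    {b : P ⟶ B} {a : J → (P ⟶ A)}
    (h : ∀ i, IsWidePullback (fun _ : J => q.app i) (b.app i) (fun j => (a j).app i))
    {X : C} (s : Germ X (IndCat.mk I B)) (t : J → Germ X (IndCat.mk I A))
    (hst : ∀ j, (t j).comp (levelMap q) = s) :
    ∃! l : Germ X (IndCat.mk I P), l.comp (levelMap b) = s ∧
      ∀ j, l.comp (levelMap (a j)) = t j := by
  refine existsUnique_of_exists_of_unique ?_ ?_
  · obtain ⟨i, x, rfl⟩ := germ_ind s
    obtain ⟨k, f, y, hy⟩ := exists_common_germs (Y := IndCat.mk I A) i t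
    have e : ∀ j, germ (Y := IndCat.mk I B) k (y j ≫ q.app k) =
        germ (Y := IndCat.mk I B) k (x ≫ B.map f) := fun j => by
      rw [← germ_comp_levelMap, hy, hst]
      exact (germ_map (Y := IndCat.mk I B) f x).symm
    -- The equations over the base hold at `k` only as germs; at stage `m` they hold strictly, so
    -- the pullback in $\mathscr C$ at level `m` applies.
    obtain ⟨m, g, hg⟩ := exists_map_eq e
    obtain ⟨l, ⟨hb, ha⟩, -⟩ := (h m).existsUnique ((x ≫ B.map f) ≫ B.map g)
      (fun j => y j ≫ A.map g) (fun j => by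
        rw [Category.assoc, q.naturality, ← Category.assoc]
        exact hg j)
    refine ⟨germ (Y := IndCat.mk I P) m l, ?_, fun j => ?_⟩
    · rw [germ_comp_levelMap, hb]
      exact (germ_map (Y := IndCat.mk I B) g (x ≫ B.map f)).trans
        (germ_map (Y := IndCat.mk I B) f x)
    · rw [germ_comp_levelMap, ha, ← hy]
      exact germ_map (Y := IndCat.mk I A) g (y j)
  · rintro l l' ⟨hb, ha⟩ ⟨hb', ha'⟩
    obtain ⟨k, x, y, rfl, rfl⟩ := exists_common_germ l l'
    obtain ⟨m, f, hf⟩ := germ_eq_iff.1 (hb.trans hb'.symm)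
    obtain ⟨n, g, hg⟩ := exists_map_eq (fun j => (ha j).trans (ha' j).symm)
    -- The base components agree after `f` and the others after `g`. Closing the span gives one
    -- arrow `f ≫ f' = g ≫ g'` after which all components agree.
    obtain ⟨r, f', g', e⟩ := IsFiltered.span f g
    refine germ_eq_iff.2 ⟨r, f ≫ f', (h r).hom_ext ?_ fun j => ?_⟩
    · have := congrArg (· ≫ B.map f') hf
      dsimp at this ⊢
      simpa [b.naturality] using this
    · have := congrArg (· ≫ A.map g') (hg j)
      dsimp at this ⊢
      rw [e]
      simpa [(a j).naturality] using this

/-- A morphism out of `Z` is a compatible family of germs, so the germ statement applies at each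
index of `Z`. -/
theorem isWidePullback_levelMap {J : Type*} [Finite J] {P A B : I ⥤ C} {q : A ⟶ B}
    {b : P ⟶ B} {a : J → (P ⟶ A)}
    (h : ∀ i, IsWidePullback (fun _ : J => q.app i) (b.app i) (fun j => (a j).app i)) :
    IsWidePullback (fun _ : J => levelMap q) (levelMap b) (fun j => levelMap (a j)) where
  w j := by
    rw [← levelMap_comp]
    congr 1
    ext i
    exact (h i).w j
  existsUnique {Z} s t hst := by
    have key (i : Z.I) := existsUnique_germ_of_isWidePullback h (s.val i) (fun j => (t j).val i)
      (fun j => congrArg (fun f => Hom.val f i) (hst j))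
    choose l hl hu using key
    -- Compatibility of the chosen germs is forced by uniqueness: the restriction of `l i'` along
    -- `f` solves the same lifting problem as `l i`.
    refine ⟨⟨l, fun {i i'} f => hu i _ ⟨?_, fun j => ?_⟩⟩,
      ⟨hom_ext fun i => (hl i).1, fun j => hom_ext fun i => (hl i).2 j⟩, ?_⟩
    · rw [Germ.precomp_comp_hom, (hl i').1, Hom.compat]
    · rw [Germ.precomp_comp_hom, (hl i').2, Hom.compat]
    · rintro m ⟨hb, ha⟩
      exact hom_ext fun i => hu i _ ⟨congrArg (fun f => Hom.val f i) hb,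
        fun j => congrArg (fun f => Hom.val f i) (ha j)⟩

/-- Filtered colimits of sets commute with equalizers: a germ equalizing `f` and `g` has a
representative that does so strictly at a later stage. -/
theorem existsUnique_germ_of_isEqualizerMap {P A B : I ⥤ C} {f g : A ⟶ B} {ι : P ⟶ A}
    (h : ∀ i, IsEqualizerMap (f.app i) (g.app i) (ι.app i))
    {X : C} (t : Germ X (IndCat.mk I A)) (ht : t.comp (levelMap f) = t.comp (levelMap g)) :
    ∃! l : Germ X (IndCat.mk I P), l.comp (levelMap ι) = t := by
  refine existsUnique_of_exists_of_unique ?_ ?_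
  · obtain ⟨i, x, rfl⟩ := germ_ind t
    obtain ⟨m, k, hk⟩ := germ_eq_iff.1 ht
    obtain ⟨l, hl, -⟩ := (h m).existsUnique (x ≫ A.map k) (by
      dsimp at hk
      simpa using hk)
    refine ⟨germ (Y := IndCat.mk I P) m l, ?_⟩
    rw [germ_comp_levelMap, hl]
    exact germ_map (Y := IndCat.mk I A) k x
  · rintro l l' hl hl'
    obtain ⟨k, x, y, rfl, rfl⟩ := exists_common_germ l l'
    obtain ⟨m, k', hk⟩ := germ_eq_iff.1 (hl.trans hl'.symm)
    refine germ_eq_iff.2 ⟨m, k', (h m).hom_ext ?_⟩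
    dsimp at hk ⊢
    simpa using hk

theorem isEqualizerMap_levelMap {P A B : I ⥤ C} {f g : A ⟶ B} {ι : P ⟶ A}
    (h : ∀ i, IsEqualizerMap (f.app i) (g.app i) (ι.app i)) :
    IsEqualizerMap (levelMap f) (levelMap g) (levelMap ι) where
  w := by
    rw [← levelMap_comp, ← levelMap_comp]
    congr 1
    ext i
    exact (h i).w
  existsUnique {Z} t ht := by
    have key (i : Z.I) := existsUnique_germ_of_isEqualizerMap h (t.val i)
      (congrArg (fun f => Hom.val f i) ht)
    choose l hl hu using key
    refine ⟨⟨l, fun {i i'} f => hu i _ ?_⟩, hom_ext hl, fun m hm => ?_⟩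
    · dsimp
      rw [Germ.precomp_comp_hom, hl i', Hom.compat]
    · exact hom_ext fun i => hu i _ (congrArg (fun f => Hom.val f i) hm)

end

end IndCat

/-! ### Fibre powers in the base category -/

section Powers

variable {C : Type u} [Category.{v} C] {T : C ⥤ C} (p : T ⟶ 𝟭 C) [HasPullbackPowers p]

lemma isWidePullback_power (n : ℕ) (X : C) :
    IsWidePullback (fun _ : Fin n => p.app X) (powerBase p n X) (powerProj p n X) :=
  isWidePullback_of_isLimit (limit.isLimit (powerCospan p n X))

/-- The structure maps `T_n X ⟶ X` as a natural transformation. -/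
noncomputable def powerBaseNat (n : ℕ) : powerFunctor p n ⟶ 𝟭 C where
  app X := powerBase p n X
  naturality _ _ _ := powerLift_base p _ _ _

variable {p}

/-- The base component is the first projection followed by $p$, so it need not be compared
separately. -/
lemma pairLift_hom_ext {X Z : C} {f g : Z ⟶ (powerFunctor p 2).obj X}
    (h : ∀ i, f ≫ (powerπ p 2 i).app X = g ≫ (powerπ p 2 i).app X) : f = g := by
  refine power_hom_ext p ?_ h
  rw [← powerProj_p p 2 X 0]
  exact (Category.assoc _ _ _).symm.trans
    ((congrArg (· ≫ p.app X) (h 0)).trans (Category.assoc _ _ _))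

lemma isWidePullback_map_power (F : C ⥤ C) (n : ℕ) (X : C)
    [PreservesLimit (powerCospan p n X) F] :
    IsWidePullback (fun _ : Fin n => F.map (p.app X)) (F.map (powerBase p n X))
      (fun j => F.map (powerProj p n X j)) :=
  isWidePullback_of_isLimit (isLimitOfPreserves F (limit.isLimit (powerCospan p n X)))

end Powers

/-! ### Fibre powers in the ind-category and their preservation -/

namespace IndCat

variable {C : Type u} [Category.{v} C] {T : C ⥤ C}

/-- The whiskering of `p` with the diagram of an ind-object. -/
def levelP (p : T ⟶ 𝟭 C) (X : IndCat.{w} C) : X.F ⋙ T ⟶ X.F where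
  app i := p.app (X.F.obj i)
  naturality _ _ f := p.naturality (X.F.map f)

/-- The identification $\mathrm{Ind}(\mathrm{id})=\mathrm{id}$ contributes only identities at each
level. Removing them puts $\mathrm{Ind}(p)$ in a form where levelwise arguments apply. -/
lemma indP_app (p : T ⟶ 𝟭 C) (X : IndCat.{w} C) : (indP p).app X = levelMap (levelP p X) := by
  ext i
  exact congrArg (germ (Y := X) i) (Category.comp_id _)

variable (p : T ⟶ 𝟭 C) [HasPullbackPowers p]

/-- The structure map of the levelwise power `Ind(T_n) X`, at each level. -/
noncomputable def levelBase (n : ℕ) (X : IndCat.{w} C) : X.F ⋙ powerFunctor p n ⟶ X.F where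
  app i := powerBase p n (X.F.obj i)
  naturality _ _ f := (powerBaseNat p n).naturality (X.F.map f)

/-- The structure map of the levelwise power `Ind(T_n) X`. -/
noncomputable def levelPowerBase (n : ℕ) (X : IndCat.{w} C) :
    (map (powerFunctor p n)).obj X ⟶ X :=
  levelMap (levelBase p n X)

lemma isWidePullback_levelPower (n : ℕ) (X : IndCat.{w} C) :
    IsWidePullback (fun _ : Fin n => (indP p).app X) (levelPowerBase p n X)
      (fun j => (mapNat (powerπ p n j)).app X) := by
  rw [indP_app]
  exact isWidePullback_levelMap (a := fun j => Functor.whiskerLeft X.F (powerπ p n j))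
    fun i => isWidePullback_power p n (X.F.obj i)

/-- Applying `F` levelwise to the pullbacks $T_nX_i$ again gives pullbacks at every level. The
functor is left general so that it can be an iterate of $T$. -/
lemma isWidePullback_map_levelPower (n : ℕ) (X : IndCat.{w} C) (F : C ⥤ C)
    (hF : ∀ A, PreservesLimit (powerCospan p n A) F) :
    IsWidePullback (fun _ : Fin n => (map F).map ((indP p).app X))
      ((map F).map (levelPowerBase p n X))
      (fun j => (map F).map ((mapNat (powerπ p n j)).app X)) := by
  rw [indP_app]
  exact isWidePullback_levelMap (q := Functor.whiskerRight (levelP p X) F)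
    (b := Functor.whiskerRight (levelBase p n X) F)
    (a := fun j => Functor.whiskerRight (Functor.whiskerLeft X.F (powerπ p n j)) F)
    fun i => have := hF (X.F.obj i); isWidePullback_map_power F n (X.F.obj i)

/-- The levelwise power `Ind(T_n) X` as a cone. -/
noncomputable def levelPowerCone (n : ℕ) (X : IndCat.{w} C) :
    Cone (powerCospan (indP.{w} p) n X) :=
  WidePullbackShape.mkCone (F := powerCospan (indP.{w} p) n X) (levelPowerBase p n X)
    (fun j => (mapNat (powerπ p n j)).app X) (isWidePullback_levelPower p n X).w

lemma nonempty_isLimit_levelPowerCone (n : ℕ) (X : IndCat.{w} C) :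
    Nonempty (IsLimit (levelPowerCone p n X)) :=
  nonempty_isLimit_of_isWidePullback (isWidePullback_levelPower p n X)

instance hasPullbackPowers_indP : HasPullbackPowers (indP.{w} p) where
  hasLimit n X := ⟨⟨⟨levelPowerCone p n X, (nonempty_isLimit_levelPowerCone p n X).some⟩⟩⟩

lemma preservesLimit_map (n : ℕ) (X : IndCat.{w} C) (F : C ⥤ C)
    (hF : ∀ A, PreservesLimit (powerCospan p n A) F) :
    PreservesLimit (powerCospan (indP.{w} p) n X) (map F) :=
  preservesLimit_of_preserves_limit_cone (nonempty_isLimit_levelPowerCone p n X).some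
    (nonempty_isLimit_of_isWidePullback (isWidePullback_map_levelPower p n X F hF)).some

/-- The iterates of `Ind(T)` are induced by the iterates of `T`. -/
def iterFunctorMapIso (T : C ⥤ C) : ∀ k : ℕ, map.{w} (iterFunctor T k) ≅ iterFunctor (map.{w} T) k
  | 0 => mapId C
  | k + 1 => (mapComp (iterFunctor T k) T).symm ≪≫
      Functor.isoWhiskerRight (iterFunctorMapIso T k) (map T)

variable {p} in
lemma preservesPullbackPowers_indP (hT : PreservesPullbackPowers p) :
    PreservesPullbackPowers (indP.{w} p) := fun k n X =>
  have := preservesLimit_map p n X (iterFunctor T k) (fun A => hT k n A)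
  -- Preservation is known for $\mathrm{Ind}(T^k)$ and is transported to $\mathrm{Ind}(T)^k$.
  preservesLimit_of_natIso _ (iterFunctorMapIso T k)

/-- The levelwise power `Ind(T_n) X` is the power `Ind(T)_n X`. -/
noncomputable def levelPowerIso (n : ℕ) (X : IndCat.{w} C) :
    (map (powerFunctor p n)).obj X ≅ (powerFunctor (indP.{w} p) n).obj X :=
  (nonempty_isLimit_levelPowerCone p n X).some.conePointUniqueUpToIso
    (limit.isLimit (powerCospan (indP.{w} p) n X))

lemma levelPowerIso_hom_π (n : ℕ) (X : IndCat.{w} C) (i : Fin n) :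
    (levelPowerIso p n X).hom ≫ (powerπ (indP.{w} p) n i).app X =
      (mapNat (powerπ p n i)).app X :=
  
  IsLimit.conePointUniqueUpToIso_hom_comp (nonempty_isLimit_levelPowerCone p n X).some
    (limit.isLimit (powerCospan (indP.{w} p) n X)) (some i)

lemma powerComparison_app (X : IndCat.{w} C) :
    (powerComparison p).app X = (levelPowerIso p 2 X).hom := by
  refine pairLift_hom_ext fun i => ?_
  rw [levelPowerIso_hom_π]
  fin_cases i
  · exact pairLift_fst _ _ (powerComparison_w p 0 1 X)
  · exact pairLift_snd _ _ (powerComparison_w p 0 1 X)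

instance isIso_powerComparison : IsIso (powerComparison.{w} p) :=
  have (X : IndCat.{w} C) : IsIso ((powerComparison p).app X) := by
    rw [powerComparison_app]
    infer_instance
  NatIso.isIso_of_isIso_app _

end IndCat

/-! ### Levelwise form of the structure maps and of pairings -/

lemma mapPairLift_hom_ext {C : Type u} [Category.{v} C] {T : C ⥤ C} {p : T ⟶ 𝟭 C}
    [HasPullbackPowers p] (hT : PreservesPullbackPowers p) {X Z : C}
    {f g : Z ⟶ T.obj ((powerFunctor p 2).obj X)}
    (h : ∀ i, f ≫ T.map ((powerπ p 2 i).app X) = g ≫ T.map ((powerπ p 2 i).app X)) : f = g := by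
  have : PreservesLimit (powerCospan p 2 X) T := hT 1 2 X
  refine (isWidePullback_map_power (p := p) T 2 X).hom_ext ?_ h
  rw [← powerProj_p p 2 X 0, T.map_comp]
  exact (Category.assoc _ _ _).symm.trans
    ((congrArg (· ≫ T.map (p.app X)) (h 0)).trans (Category.assoc _ _ _))

namespace IndCat

variable {C : Type u} [Category.{v} C] {T : C ⥤ C}

/-- The whiskering of `zero` with the diagram of an ind-object. -/
def levelZero (zero : 𝟭 C ⟶ T) (X : IndCat.{w} C) : X.F ⟶ X.F ⋙ T where
  app i := zero.app (X.F.obj i)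
  naturality _ _ f := zero.naturality (X.F.map f)

/-- The whiskering of `lift` with the diagram of an ind-object. -/
def levelLift (lift : T ⟶ T ⋙ T) (X : IndCat.{w} C) : X.F ⋙ T ⟶ (X.F ⋙ T) ⋙ T where
  app i := lift.app (X.F.obj i)
  naturality _ _ f := lift.naturality (X.F.map f)

/-- The whiskering of `flip` with the diagram of an ind-object. -/
def levelFlip (flip : T ⋙ T ⟶ T ⋙ T) (X : IndCat.{w} C) :
    (X.F ⋙ T) ⋙ T ⟶ (X.F ⋙ T) ⋙ T where
  app i := flip.app (X.F.obj i)
  naturality _ _ f := flip.naturality (X.F.map f)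

lemma indZero_app (zero : 𝟭 C ⟶ T) (X : IndCat.{w} C) :
    (indZero zero).app X = levelMap (levelZero zero X) := by
  ext i
  exact congrArg (germ (Y := mapObj T X) i) (Category.id_comp _)

lemma indLift_app (lift : T ⟶ T ⋙ T) (X : IndCat.{w} C) :
    (indLift lift).app X = levelMap (levelLift lift X) := by
  ext i
  exact congrArg (germ (Y := mapObj T (mapObj T X)) i) (Category.comp_id _)

lemma indFlip_app (flip : T ⋙ T ⟶ T ⋙ T) (X : IndCat.{w} C) :
    (indFlip flip).app X = levelMap (levelFlip flip X) := by
  ext i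
  exact congrArg (germ (Y := mapObj T (mapObj T X)) i)
    ((Category.id_comp _).trans (Category.comp_id _))

lemma levelMap_congr {I : Type w} [SmallCategory I] [IsFiltered I] {F G : I ⥤ C} {ρ σ : F ⟶ G}
    (h : ∀ i, ρ.app i = σ.app i) : levelMap ρ = levelMap σ :=
  congrArg levelMap (NatTrans.ext (funext h))

variable {p : T ⟶ 𝟭 C} [HasPullbackPowers p]

/-- The map `⟨a, b⟩ : F ⟶ T_2 G` of diagrams. -/
noncomputable def levelPair {I : Type w} [SmallCategory I] {F G : I ⥤ C} (a b : F ⟶ G ⋙ T)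
    (h : ∀ i, a.app i ≫ p.app (G.obj i) = b.app i ≫ p.app (G.obj i)) :
    F ⟶ G ⋙ powerFunctor p 2 where
  app i := pairLift (a.app i) (b.app i) (h i)
  naturality i j f := by
    refine pairLift_hom_ext fun k => ?_
    have e := (powerπ p 2 k).naturality (G.map f)
    dsimp at e ⊢
    rw [Category.assoc, Category.assoc, e]
    fin_cases k
    · exact (congrArg (F.map f ≫ ·) (pairLift_fst _ _ (h j))).trans
        ((a.naturality f).trans (pairLift_fst_assoc _ _ (h i) _).symm)
    · exact (congrArg (F.map f ≫ ·) (pairLift_snd _ _ (h j))).trans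
        ((b.naturality f).trans (pairLift_snd_assoc _ _ (h i) _).symm)

/-- The map `⟨a, b⟩ : F ⟶ T (T_2 G)` of diagrams. -/
noncomputable def levelMapPair (hT : PreservesPullbackPowers p) {I : Type w} [SmallCategory I]
    {F G : I ⥤ C} (a b : F ⟶ (G ⋙ T) ⋙ T)
    (h : ∀ i, a.app i ≫ T.map (p.app (G.obj i)) = b.app i ≫ T.map (p.app (G.obj i))) :
    F ⟶ (G ⋙ powerFunctor p 2) ⋙ T where
  app i := mapPairLift hT (a.app i) (b.app i) (h i)
  naturality i j f := by
    refine mapPairLift_hom_ext hT fun k => ?_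
    have e := congrArg T.map ((powerπ p 2 k).naturality (G.map f))
    rw [T.map_comp, T.map_comp] at e
    dsimp at e ⊢
    rw [Category.assoc, Category.assoc, e]
    fin_cases k
    · exact (congrArg (F.map f ≫ ·) (mapPairLift_fst hT _ _ (h j))).trans
        ((a.naturality f).trans ((congrArg (· ≫ T.map (T.map (G.map f)))
          (mapPairLift_fst hT _ _ (h i)).symm).trans (Category.assoc _ _ _)))
    · exact (congrArg (F.map f ≫ ·) (mapPairLift_snd hT _ _ (h j))).trans
        ((b.naturality f).trans ((congrArg (· ≫ T.map (T.map (G.map f)))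
          (mapPairLift_snd hT _ _ (h i)).symm).trans (Category.assoc _ _ _)))

/-- The map `⟨a, b⟩` of diagrams, as a morphism to the levelwise power. -/
noncomputable def pairMap {X : IndCat.{w} C} {F : X.I ⥤ C} (a b : F ⟶ X.F ⋙ T)
    (h : ∀ i, a.app i ≫ p.app (X.F.obj i) = b.app i ≫ p.app (X.F.obj i)) :
    IndCat.mk X.I F ⟶ (map (powerFunctor p 2)).obj X :=
  levelMap (levelPair a b h)

/-- The map `⟨a, b⟩` of diagrams, as a morphism to the image of the levelwise power. -/
noncomputable def mapPairMap (hT : PreservesPullbackPowers p) {X : IndCat.{w} C} {F : X.I ⥤ C}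
    (a b : F ⟶ (X.F ⋙ T) ⋙ T)
    (h : ∀ i, a.app i ≫ T.map (p.app (X.F.obj i)) = b.app i ≫ T.map (p.app (X.F.obj i))) :
    IndCat.mk X.I F ⟶ (map T).obj ((map (powerFunctor p 2)).obj X) :=
  levelMap (levelMapPair hT a b h)

/-- The comparison $\theta$ cancels its inverse in the definition of $\hat+$. -/
lemma levelPowerIso_hom_indAdd (add : powerFunctor p 2 ⟶ T) (X : IndCat.{w} C) :
    (levelPowerIso p 2 X).hom ≫ (indAdd p add).app X =
      levelMap (Functor.whiskerLeft X.F add) := by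
  rw [← powerComparison_app, ← NatTrans.comp_app, indAdd, IsIso.hom_inv_id_assoc]
  rfl

/-- Both ways of pairing have the same projections. The map `u` is there because `Z` may be a chosen
power, which is not literally levelwise; `u` is then the isomorphism from the levelwise one. -/
lemma comp_pairLift_indAdd (add : powerFunctor p 2 ⟶ T) {X Z : IndCat.{w} C} {F : X.I ⥤ C}
    (u : IndCat.mk X.I F ⟶ Z) {a b : Z ⟶ (map T).obj X}
    (h : a ≫ (indP p).app X = b ≫ (indP p).app X) {α β : F ⟶ X.F ⋙ T}
    (hα : u ≫ a = levelMap α) (hβ : u ≫ b = levelMap β)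
    (h' : ∀ i, α.app i ≫ p.app (X.F.obj i) = β.app i ≫ p.app (X.F.obj i)) :
    u ≫ pairLift a b h ≫ (indAdd p add).app X =
      levelMap (levelPair α β h' ≫ Functor.whiskerLeft X.F add) := by
  have e : u ≫ pairLift a b h =
      pairMap α β h' ≫ (levelPowerIso p 2 X).hom := by
    refine pairLift_hom_ext fun i => ?_
    rw [Category.assoc, Category.assoc, levelPowerIso_hom_π]
    fin_cases i
    · refine (congrArg (u ≫ ·) (pairLift_fst a b h)).trans (hα.trans ?_)
      exact hom_ext fun i => congrArg (germ (Y := mapObj T X) i)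
        (pairLift_fst _ _ (h' i)).symm
    · refine (congrArg (u ≫ ·) (pairLift_snd a b h)).trans (hβ.trans ?_)
      exact hom_ext fun i => congrArg (germ (Y := mapObj T X) i)
        (pairLift_snd _ _ (h' i)).symm
  rw [← Category.assoc, e, Category.assoc, levelPowerIso_hom_indAdd]
  rfl

lemma pairLift_indAdd (add : powerFunctor p 2 ⟶ T) {X : IndCat.{w} C} {F : X.I ⥤ C}
    {a b : IndCat.mk X.I F ⟶ (map T).obj X}
    (h : a ≫ (indP p).app X = b ≫ (indP p).app X) {α β : F ⟶ X.F ⋙ T}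
    (hα : a = levelMap α) (hβ : b = levelMap β)
    (h' : ∀ i, α.app i ≫ p.app (X.F.obj i) = β.app i ≫ p.app (X.F.obj i)) :
    pairLift a b h ≫ (indAdd p add).app X =
      levelMap (levelPair α β h' ≫ Functor.whiskerLeft X.F add) :=
  (Category.id_comp _).symm.trans (comp_pairLift_indAdd add (𝟙 _) h
    ((Category.id_comp _).trans hα) ((Category.id_comp _).trans hβ) h')

/-- The analogue for pairings into $T(T_2X)$, used for the universality axiom; projections are
compared after applying $\mathrm{Ind}(T)$. -/
lemma comp_mapPairLift_indAdd (hT : PreservesPullbackPowers p)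
    (hI : PreservesPullbackPowers (indP.{w} p)) (add : powerFunctor p 2 ⟶ T)
    {X Z : IndCat.{w} C} {F : X.I ⥤ C}
    (u : IndCat.mk X.I F ⟶ Z) {a b : Z ⟶ (map T).obj ((map T).obj X)}
    (h : a ≫ (map T).map ((indP p).app X) = b ≫ (map T).map ((indP p).app X))
    {α β : F ⟶ (X.F ⋙ T) ⋙ T} (hα : u ≫ a = levelMap α) (hβ : u ≫ b = levelMap β)
    (h' : ∀ i, α.app i ≫ T.map (p.app (X.F.obj i)) = β.app i ≫ T.map (p.app (X.F.obj i))) :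
    u ≫ mapPairLift hI a b h ≫ (map T).map ((indAdd p add).app X) =
      levelMap (levelMapPair hT α β h' ≫
        Functor.whiskerRight (Functor.whiskerLeft X.F add) T) := by
  have e : u ≫ mapPairLift hI a b h =
      mapPairMap hT α β h' ≫ (map T).map (levelPowerIso p 2 X).hom := by
    refine mapPairLift_hom_ext hI fun i => ?_
    rw [Category.assoc, Category.assoc, ← Functor.map_comp, levelPowerIso_hom_π]
    fin_cases i
    · refine (congrArg (u ≫ ·) (mapPairLift_fst hI a b h)).trans (hα.trans ?_)
      exact hom_ext fun i => congrArg (germ (Y := mapObj T (mapObj T X)) i)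
        (mapPairLift_fst hT _ _ (h' i)).symm
    · refine (congrArg (u ≫ ·) (mapPairLift_snd hI a b h)).trans (hβ.trans ?_)
      exact hom_ext fun i => congrArg (germ (Y := mapObj T (mapObj T X)) i)
        (mapPairLift_snd hT _ _ (h' i)).symm
  rw [← Category.assoc, e, Category.assoc, ← Functor.map_comp, levelPowerIso_hom_indAdd]
  rfl

/-! ### Verification of the tangent axioms -/

lemma isAdditiveBundle_ind {zero : 𝟭 C ⟶ T} {add : powerFunctor p 2 ⟶ T}
    (h : IsAdditiveBundle zero add) :
    IsAdditiveBundle (indZero.{w} zero) (indAdd p add) where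
  zero_p X := by
    rw [indZero_app, indP_app]
    exact hom_ext fun i =>
      congrArg (germ (Y := X) i) (h.zero_p (X.F.obj i))
  add_p X := by
    rw [← cancel_epi (levelPowerIso p 2 X).hom, ← Category.assoc, ← Category.assoc,
      levelPowerIso_hom_indAdd, levelPowerIso_hom_π, indP_app]
    exact levelMap_congr (ρ := Functor.whiskerLeft X.F add ≫ levelP p X)
      (σ := Functor.whiskerLeft X.F (powerπ p 2 0) ≫ levelP p X) fun i => h.add_p (X.F.obj i)
  zero_add X := by
    refine (pairLift_indAdd add _ (α := levelP p X ≫ levelZero zero X) (β := 𝟙 _) ?_ rfl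
      fun i => ?_).trans (levelMap_congr (σ := 𝟙 (X.F ⋙ T)) fun i => h.zero_add (X.F.obj i))
    · rw [indP_app, indZero_app]
      rfl
    · simp [levelP, levelZero, h.zero_p]
  add_zero X := by
    refine (pairLift_indAdd add _ (β := levelP p X ≫ levelZero zero X) (α := 𝟙 _) rfl ?_
      fun i => ?_).trans (levelMap_congr (σ := 𝟙 (X.F ⋙ T)) fun i => h.add_zero (X.F.obj i))
    · rw [indP_app, indZero_app]
      rfl
    · simp [levelP, levelZero, h.zero_p]
  add_comm X := by
    rw [← cancel_epi (levelPowerIso p 2 X).hom, levelPowerIso_hom_indAdd]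
    exact (comp_pairLift_indAdd add _ _ (levelPowerIso_hom_π p 2 X 1)
      (levelPowerIso_hom_π p 2 X 0) fun i => powerπ_p 1 0 (X.F.obj i)).trans
        (levelMap_congr fun i => h.add_comm (X.F.obj i))
  add_assoc X := by
    -- From $\mathrm{Ind}(T_3)\underline X$ the three projections are levelwise. Hence the inner
    -- sums are levelwise, and then so are the outer ones.
    rw [← cancel_epi (levelPowerIso p 3 X).hom]
    refine (comp_pairLift_indAdd add _ _ (comp_pairLift_indAdd add _ _
      (levelPowerIso_hom_π p 3 X 0) (levelPowerIso_hom_π p 3 X 1)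
        fun i => powerπ_p 0 1 (X.F.obj i)) (levelPowerIso_hom_π p 3 X 2) fun i => ?_).trans
      (Eq.trans ?_ (comp_pairLift_indAdd add _ _ (levelPowerIso_hom_π p 3 X 0)
        (comp_pairLift_indAdd add _ _
          (levelPowerIso_hom_π p 3 X 1) (levelPowerIso_hom_π p 3 X 2)
            fun i => powerπ_p 1 2 (X.F.obj i)) fun i => ?_).symm)
    · exact ((Category.assoc _ _ _).trans (congrArg _ (h.add_p _))).trans
        ((pairLift_fst_assoc _ _ (powerπ_p 0 1 _) _).trans (powerπ_p 0 2 _))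
    · exact levelMap_congr fun i => h.add_assoc (X.F.obj i)
    · exact (powerπ_p 0 1 _).trans (((Category.assoc _ _ _).trans (congrArg _ (h.add_p _))).trans
        (pairLift_fst_assoc _ _ (powerπ_p 1 2 _) _)).symm

end IndCat

open IndCat in
theorem theorem3 {C : Type u} [Category.{v} C] (T : C ⥤ C) (p : T ⟶ 𝟭 C) [HasPullbackPowers p]
    (zero : 𝟭 C ⟶ T) (add : powerFunctor p 2 ⟶ T)
    (lift : T ⟶ T ⋙ T) (flip : T ⋙ T ⟶ T ⋙ T)
    (hT : IsTangentStructure T p zero add lift flip) :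
    ∃ (_ : HasPullbackPowers (IndCat.indP.{w} p)) (_ : IsIso (IndCat.powerComparison.{w} p)),
      IsTangentStructure (IndCat.map.{w} T) (IndCat.indP p) (IndCat.indZero zero)
        (IndCat.indAdd p add) (IndCat.indLift lift) (IndCat.indFlip flip) := by
  -- This makes $\langle\ell\pi_1,\ell\pi_2\rangle$ well defined at each level, as needed for the
  -- additivity of $\hat\ell$.
  have hlp (X : C) : lift.app X ≫ p.app (T.obj X) = p.app X ≫ zero.app X := by
    rw [← hT.lift_flip, Category.assoc, hT.flip_p, hT.lift_p]
  refine ⟨inferInstance, inferInstance, ?_⟩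
  refine
    { preserves := preservesPullbackPowers_indP hT.preserves
      additive := isAdditiveBundle_ind hT.additive
      flip_p := fun X => ?_
      flip_add := fun X => ?_
      flip_zero := fun X => ?_
      flip_flip := fun X => ?_
      lift_flip := fun X => ?_
      lift_lift := fun X => ?_
      flip_braid := fun X => ?_
      flip_lift := fun X => ?_
      lift_p := fun X => ?_
      lift_add := fun X => ?_
      lift_zero := fun X => ?_
      universal := fun X => ?_ }
  · rw [indFlip_app, indP_app, indP_app]
    exact hom_ext fun i =>
      congrArg (germ (Y := mapObj T X) i) (hT.flip_p (X.F.obj i))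
  -- The source is $\mathrm{Ind}(T)(\mathrm{Ind}(T)_2\underline X)$, so the isomorphism to cancel is
  -- the image of `levelPowerIso` under $\mathrm{Ind}(T)$.
  · rw [← cancel_epi ((map T).map (levelPowerIso p 2 X).hom), ← Category.assoc,
      ← Functor.map_comp, levelPowerIso_hom_indAdd]
    have e (k : Fin 2) : (map T).map (levelPowerIso p 2 X).hom ≫
        (map T).map ((powerπ (indP p) 2 k).app X) ≫ (indFlip flip).app X =
        levelMap (Functor.whiskerRight (Functor.whiskerLeft X.F (powerπ p 2 k)) T ≫
          levelFlip flip X) := by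
      rw [← Category.assoc, ← Functor.map_comp, levelPowerIso_hom_π, indFlip_app]
      rfl
    refine Eq.trans ?_ (comp_pairLift_indAdd (X := (map T).obj X) add _ _ (e 0) (e 1)
      fun i => ?_).symm
    · rw [indFlip_app]
      exact hom_ext fun i =>
        congrArg (germ (Y := mapObj T (mapObj T X)) i) (hT.flip_add (X.F.obj i))
    · have h (k : Fin 2) :
          (T.map ((powerπ p 2 k).app (X.F.obj i)) ≫ flip.app _) ≫ p.app (T.obj _) =
            T.map ((powerπ p 2 k).app (X.F.obj i) ≫ p.app _) := by
        rw [Category.assoc, hT.flip_p, T.map_comp]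
      exact (h 0).trans ((congrArg T.map (powerπ_p 0 1 _)).trans (h 1).symm)
  · rw [indFlip_app, indZero_app, indZero_app]
    exact hom_ext fun i =>
      congrArg (germ (Y := mapObj T (mapObj T X)) i) (hT.flip_zero (X.F.obj i))
  · rw [indFlip_app]
    exact hom_ext fun i =>
      congrArg (germ (Y := mapObj T (mapObj T X)) i) (hT.flip_flip (X.F.obj i))
  · rw [indFlip_app, indLift_app]
    exact hom_ext fun i =>
      congrArg (germ (Y := mapObj T (mapObj T X)) i) (hT.lift_flip (X.F.obj i))
  · rw [indLift_app, indLift_app]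
    exact hom_ext fun i =>
      congrArg (germ (Y := mapObj T (mapObj T (mapObj T X))) i) (hT.lift_lift (X.F.obj i))
  · rw [indFlip_app, indFlip_app]
    exact hom_ext fun i =>
      congrArg (germ (Y := mapObj T (mapObj T (mapObj T X))) i) (hT.flip_braid (X.F.obj i))
  · rw [indFlip_app, indFlip_app, indLift_app, indLift_app]
    exact hom_ext fun i =>
      congrArg (germ (Y := mapObj T (mapObj T (mapObj T X))) i) (hT.flip_lift (X.F.obj i))
  · rw [indLift_app, indP_app, indZero_app]
    exact hom_ext fun i =>
      congrArg (germ (Y := mapObj T X) i) (hT.lift_p (X.F.obj i))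
  · rw [← cancel_epi (levelPowerIso p 2 X).hom, ← Category.assoc, levelPowerIso_hom_indAdd]
    have e (k : Fin 2) : (levelPowerIso p 2 X).hom ≫
        (powerπ (indP p) 2 k).app X ≫ (indLift lift).app X =
        levelMap (Functor.whiskerLeft X.F (powerπ p 2 k) ≫ levelLift lift X) := by
      rw [← Category.assoc, levelPowerIso_hom_π, indLift_app]
      rfl
    refine Eq.trans ?_ (comp_pairLift_indAdd (X := (map T).obj X) add _ _ (e 0) (e 1)
      fun i => ?_).symm
    · rw [indLift_app]
      exact hom_ext fun i =>
        congrArg (germ (Y := mapObj T (mapObj T X)) i) (hT.lift_add (X.F.obj i))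
    · have := powerπ_p_assoc (p := p) (n := 2) 0 1 (X.F.obj i) (zero.app _)
      exact (Category.assoc _ _ _).trans ((congrArg _ (hlp _)).trans (this.trans
        ((congrArg _ (hlp _).symm).trans (Category.assoc _ _ _).symm)))
  · rw [indLift_app, indZero_app, indZero_app]
    exact hom_ext fun i =>
      congrArg (germ (Y := mapObj T (mapObj T X)) i) (hT.lift_zero (X.F.obj i))
  · have e₁ : (levelPowerIso p 2 X).hom ≫
        (powerπ (indP p) 2 0).app X ≫ (indLift lift).app X =
        levelMap (Functor.whiskerLeft X.F (powerπ p 2 0) ≫ levelLift lift X) := by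
      rw [← Category.assoc, levelPowerIso_hom_π, indLift_app]
      rfl
    have e₂ : (levelPowerIso p 2 X).hom ≫
        (powerπ (indP p) 2 1).app X ≫ (indZero zero).app ((map T).obj X) =
        levelMap (Functor.whiskerLeft X.F (powerπ p 2 1) ≫ levelZero zero ((map T).obj X)) := by
      rw [← Category.assoc, levelPowerIso_hom_π, indZero_app]
      rfl
    -- The map in the universality axiom equals the inverse of `levelPowerIso` followed by its
    -- levelwise counterpart, so it suffices that the latter is an equalizer.
    refine isEqualizerMap_iff.1 (Eq.mpr (congrArg (IsEqualizerMap _ _)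
      ((Iso.eq_inv_comp (levelPowerIso p 2 X)).2 (comp_mapPairLift_indAdd hT.preserves _ add _ _
        e₁ e₂ fun i => ?_))) (IsEqualizerMap.comp_iso ?_ _))
    -- The levelwise pairing is well defined:
    -- $T(p)\,\ell\,\pi_1=0\,p\,\pi_1=0\,p\,\pi_2=T(p)\,0_T\,\pi_2$, the last equality by naturality
    -- of $0$.
    · exact (Category.assoc _ _ _).trans ((congrArg _ (hT.lift_p _)).trans
        ((powerπ_p_assoc 0 1 (X.F.obj i) (zero.app _)).trans
          ((congrArg _ (zero.naturality (p.app (X.F.obj i)))).trans (Category.assoc _ _ _).symm)))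
    · rw [indP_app, indP_app, indZero_app]
      exact isEqualizerMap_levelMap (f := Functor.whiskerRight (levelP p X) T)
        (g := levelP p ((map T).obj X) ≫ levelP p X ≫ levelZero zero X)
        fun i => isEqualizerMap_iff.2 (hT.universal (X.F.obj i))
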